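/- Let $G$ be a finite group, $K\subseteq G$ a subgroup and $R\subseteq G$ a transversal, i.e. $e\in R$ and every element of $G$ is uniquely of the form $rx$ with $r\in R$, $x\in K$. Let $K$ act on $R$ by letting $x\triangleright r$ be the representative of the coset $xrK$. Let $\Xi=\Xi(R,K)$ be the algebra with basis $\delta_r\otimes x$ ($r\in R$, $x\in K$), the cross product of $\mathbb{C}(R)$ and $\mathbb{C}K$ with $x\delta_r=\delta_{x\triangleright r}x$, and let $D(G)$ be the quantum double, the cross product of $\mathbb{C}(G)$ and $\mathbb{C}G$ with $h\delta_g=\delta_{hgh^{-1}}h$. Let $i:\Xi\hookrightarrow D(G)$ be the algebra inclusion $i(x)=x$, $i(\delta_r)=\sum_{y\in K}\delta_{ry}$. Let $\mathcal{O}\subseteq R$ be a $K$-orbit with base point $r_0$, put $K^{r}=\{x\in K: x\triangleright r=r\}$, choose $\kappa_r\in K$ for $r\in\mathcal{O}$ with $\kappa_r\triangleright r_0=r$ and $\kappa_{r_0}=e$, and let $\rho$ be a finite-dimensional complex irreducible representation of $K^{r_0}$ on $V_\rho$. Let $V_{\mathcal{O},\rho}=\mathbb{C}\mathcal{O}\otimes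 V_\rho$ be the $\Xi$-module with $\delta_r(s\otimes v)=\delta_{r,s}\,s\otimes v$ and $x(s\otimes v)=x\triangleright s\otimes\rho(\kappa_{x\triangleright s}^{-1}x\kappa_s)v$. Similarly let $\mathcal{C}\subseteq G$ be a conjugacy class with base point $c_0$, put $G^{c}=\{n\in G: ncn^{-1}=c\}$, choose $q_c\in G$ for $c\in\mathcal{C}$ with $q_cc_0q_c^{-1}=c$ and $q_{c_0}=e$, let $\pi$ be a finite-dimensional complex irreducible representation of $G^{c_0}$ on $W_\pi$, and let $W_{\mathcal{C},\pi}=\mathbb{C}\mathcal{C}\otimes W_\pi$ be the $D(G)$-module with $\delta_g(c\otimes w)=\delta_{g,c}\,c\otimes w$ and $h(c\otimes w)=hch^{-1}\otimes\pi(q_{hch^{-1}}^{-1}hq_c)w$. Then there is a natural number $n=n^{(\mathcal{O},\rho)}_{(\mathcal{C},\pi)}$ which is at the same time the multiplicity of $V_{\mathcal{O},\rho}$ in the restriction $i^*(W_{\mathcal{C},\pi})$ and the multiplicity of $W_{\mathcal{C},\pi}$ in the induced module $D(G)\otimes_\Xi V_{\mathcal{O},\rho}$ (that is, each of these two modules is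 the direct sum of exactly $n$ copies of the given irreducible module and of a submodule that contains no copy of it), \[ n=\dim\operatorname{Hom}_\Xi\big(V_{\mathcal{O},\rho},i^*(W_{\mathcal{C},\pi})\big)=\dim\operatorname{Hom}_{D(G)}\big(D(G)\otimes_\Xi V_{\mathcal{O},\rho},W_{\mathcal{C},\pi}\big), \] and \[ n=\frac{|G|}{|\mathcal{O}|\,|\mathcal{C}|\,|K^{r_0}|\,|G^{c_0}|}\sum_{\substack{r\in\mathcal{O},\ c\in\mathcal{C}\\ r^{-1}c\in K}}|K^{r,c}|\sum_{\tau\in\widehat{K^{r,c}}}n_{\tau,\tilde\rho|_{K^{r,c}}}\,n_{\tau,\tilde\pi|_{K^{r,c}}},\qquad K^{r,c}=K^r\cap G^c, \] where $\widehat{H}$ is the set of isomorphism classes of complex irreducible representations of $H$, $\tilde\rho(m)=\rho(\kappa_r^{-1}m\kappa_r)$ and $\tilde\pi(m)=\pi(q_c^{-1}mq_c)$ are the corresponding representations of $K^r$ and $G^c$, and $n_{\tau,\sigma}$ is the multiplicity of $\tau$ in $\sigma$. -/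

import Mathlib

open scoped TensorProduct

noncomputable section

namespace KitaevBoundary

universe u v w

/-! ### Multiplicities -/

section Multiplicity

variable (A : Type u) [Ring A] [Algebra ℂ A]
variable (V : Type v) [AddCommGroup V] [Module ℂ V] [Module A V] [IsScalarTower ℂ A V]
variable (M : Type w) [AddCommGroup M] [Module ℂ M] [Module A M] [IsScalarTower ℂ A M]

/-- `M` is a direct sum of `n` copies of `V` and a submodule which contains no copy of `V`
(`V` being an irreducible module): the irreducible module `V` occurs exactly `n` times in `M`. -/
def HasMultiplicity (n : ℕ) : Prop :=
  ∃ U N : Submodule A M, IsCompl U N ∧ Nonempty (U ≃ₗ[A] (Fin n → V)) ∧ ∀ f : V →ₗ[A] N, f = 0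

/-- The multiplicity `dim Hom_A(V, M)` of the irreducible module `V` in the module `M`. -/
def multiplicity : ℕ := Module.finrank ℂ (V →ₗ[A] M)

variable {A V M}

/-- The dimension of `Hom_A(V, M)` is the number of copies of `V` in `M`. -/
theorem HasMultiplicity.multiplicity_eq [FiniteDimensional ℂ V] [IsSimpleModule A V] {n : ℕ}
    (h : HasMultiplicity A V M n) : multiplicity A V M = n := by
  obtain ⟨U, N, hUN, ⟨e⟩, hN⟩ := h
  have hs : Module.finrank ℂ (V →ₗ[A] V) = 1 := by
    have hb := IsSimpleModule.algebraMap_end_bijective_of_isAlgClosed (A := A) (V := V) ℂ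
    rw [← (LinearEquiv.ofBijective (Algebra.linearMap ℂ (Module.End A V)) hb).finrank_eq]
    exact Module.finrank_self ℂ
  have hcopy : ∀ f : V →ₗ[A] M, ∀ v, f v ∈ U := by
    intro f v
    have h0 : (N.projectionOnto U hUN.symm) (f v) = 0 :=
      LinearMap.congr_fun (hN ((N.projectionOnto U hUN.symm) ∘ₗ f)) v
    exact (Submodule.projectionOnto_apply_eq_zero_iff hUN.symm).1 h0
  let Φ : (V →ₗ[A] M) ≃ₗ[ℂ] (Fin n → (V →ₗ[A] V)) :=
    { toFun := fun f i => (LinearMap.proj i) ∘ₗ e.toLinearMap ∘ₗ (f.codRestrict U (hcopy f))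
      invFun := fun g => U.subtype ∘ₗ e.symm.toLinearMap ∘ₗ (LinearMap.pi g)
      map_add' := by
        intro f g
        funext i
        ext v
        have : (f + g).codRestrict U (hcopy _) v
            = f.codRestrict U (hcopy _) v + g.codRestrict U (hcopy _) v := rfl
        simp [this]
      map_smul' := by
        intro c f
        funext i
        ext v
        have : (c • f).codRestrict U (hcopy _) v
            = (algebraMap ℂ A c) • f.codRestrict U (hcopy _) v := by
          apply Subtype.ext
          simp
        simp only [LinearMap.comp_apply, LinearEquiv.coe_coe, this, map_smul, LinearMap.proj_apply,
          Pi.smul_apply, LinearMap.smul_apply, RingHom.id_apply]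
        exact algebraMap_smul A c _
      left_inv := by
        intro f
        ext v
        have : (LinearMap.pi fun i => (LinearMap.proj i) ∘ₗ e.toLinearMap ∘ₗ
            (f.codRestrict U (hcopy f))) v = e (f.codRestrict U (hcopy f) v) := by
          funext i
          simp
        simp
      right_inv := by
        intro g
        funext i
        ext v
        have : (U.subtype ∘ₗ e.symm.toLinearMap ∘ₗ (LinearMap.pi g)).codRestrict U (hcopy _) v
            = e.symm (LinearMap.pi g v) := rfl
        simp [this] }
  have : Module.Finite ℂ (V →ₗ[A] V) := Module.finite_of_finrank_eq_succ hs
  rw [multiplicity, Φ.finrank_eq, Module.finrank_pi_fintype]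
  simp [hs]

end Multiplicity

/-! ### Restriction and induction along an algebra map -/

section RestrictInduce

variable {A : Type u} [Ring A] [Algebra ℂ A] {B : Type v} [Ring B] [Algebra ℂ B]

/-- The pull-back `i^*(M)` of a `B`-module along `i : A → B`: the element `a` acts by `i a`. -/
def Restriction (_i : A →ₐ[ℂ] B) (M : Type w) : Type w := M

namespace Restriction

variable (i : A →ₐ[ℂ] B) (M : Type w) [AddCommGroup M] [Module B M]

instance : AddCommGroup (Restriction i M) := inferInstanceAs (AddCommGroup M)

instance [Module ℂ M] : Module ℂ (Restriction i M) := inferInstanceAs (Module ℂ M)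

instance : Module A (Restriction i M) := Module.compHom M i.toRingHom

theorem smul_def (a : A) (m : M) :
    (a • (show Restriction i M from m) : Restriction i M) = (i a • m : M) := rfl

instance [Module ℂ M] [IsScalarTower ℂ B M] : IsScalarTower ℂ A (Restriction i M) where
  smul_assoc c a m := by
    change (i (c • a) • (show M from m) : M) = (c • (i a • (show M from m)) : M)
    rw [map_smul, smul_assoc]

end Restriction

/-- The relations `b i(a) ⊗ v - b ⊗ a v` of the tensor product over `A`. -/
def inductionRelations (i : A →ₐ[ℂ] B) (V : Type w) [AddCommGroup V] [Module ℂ V] [Module A V] :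
    Submodule B (B ⊗[ℂ] V) :=
  Submodule.span B {t | ∃ (b : B) (a : A) (v : V), t = (b * i a) ⊗ₜ[ℂ] v - b ⊗ₜ[ℂ] (a • v)}

/-- The induced `B`-module `B ⊗_A V`, where `a : A` acts on `B` by right multiplication by `i a`. -/
abbrev Induction (i : A →ₐ[ℂ] B) (V : Type w) [AddCommGroup V] [Module ℂ V] [Module A V] :
    Type (max v w) :=
  (B ⊗[ℂ] V) ⧸ inductionRelations i V

end RestrictInduce

/-! ### Cross product algebras and their standard modules -/

section CrossProduct

variable {K : Type u} [Group K] {X : Type v} (φ : K →* Equiv.Perm X)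

/-- The underlying space `ℂ(X) ⊗ ℂK` of the cross product algebra of an action of `K` on `X`, an
element standing for `∑ coeff x k (δ_x ⊗ k)`. -/
structure CrossProduct (φ : K →* Equiv.Perm X) where
  coeff : X → K → ℂ

namespace CrossProduct

variable {φ}

@[ext]
theorem ext' {f g : CrossProduct φ} (h : ∀ x k, f.coeff x k = g.coeff x k) : f = g := by
  obtain ⟨f⟩ := f
  obtain ⟨g⟩ := g
  congr
  exact funext fun x => funext fun k => h x k

theorem coeff_injective : Function.Injective (coeff : CrossProduct φ → X → K → ℂ) :=
  fun _ _ h => ext' fun x k => congrFun (congrFun h x) k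

instance : Zero (CrossProduct φ) := ⟨⟨0⟩⟩
instance : Add (CrossProduct φ) := ⟨fun f g => ⟨f.coeff + g.coeff⟩⟩
instance : Neg (CrossProduct φ) := ⟨fun f => ⟨-f.coeff⟩⟩
instance : Sub (CrossProduct φ) := ⟨fun f g => ⟨f.coeff - g.coeff⟩⟩
instance {S : Type*} [SMul S ℂ] : SMul S (CrossProduct φ) := ⟨fun c f => ⟨c • f.coeff⟩⟩

instance : AddCommGroup (CrossProduct φ) :=
  coeff_injective.addCommGroup _ rfl (fun _ _ => rfl) (fun _ => rfl) (fun _ _ => rfl)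
    (fun _ _ => rfl) (fun _ _ => rfl)

/-- The coefficients, as an additive map. -/
def coeffHom : CrossProduct φ →+ (X → K → ℂ) where
  toFun := coeff
  map_zero' := rfl
  map_add' _ _ := rfl

instance : Module ℂ (CrossProduct φ) := coeff_injective.module ℂ coeffHom (fun _ _ => rfl)

@[simp] theorem coeff_add (f g : CrossProduct φ) (x : X) (k : K) :
    (f + g).coeff x k = f.coeff x k + g.coeff x k := rfl

@[simp] theorem coeff_zero (x : X) (k : K) : (0 : CrossProduct φ).coeff x k = 0 := rfl

@[simp] theorem coeff_smul (c : ℂ) (f : CrossProduct φ) (x : X) (k : K) :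
    (c • f).coeff x k = c * f.coeff x k := rfl

theorem coeff_sum {ι : Type*} (s : Finset ι) (f : ι → CrossProduct φ) (x : X) (k : K) :
    (∑ i ∈ s, f i).coeff x k = ∑ i ∈ s, (f i).coeff x k := by
  have := map_sum (coeffHom (φ := φ)) f s
  change coeffHom (∑ i ∈ s, f i) x k = _
  rw [this, Finset.sum_apply, Finset.sum_apply]
  rfl

open scoped Classical in
instance : One (CrossProduct φ) := ⟨⟨fun _ k => if k = 1 then 1 else 0⟩⟩

open scoped Classical in
theorem coeff_one (x : X) (k : K) : (1 : CrossProduct φ).coeff x k = if k = 1 then 1 else 0 := rfl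

variable [Fintype K]

instance : Mul (CrossProduct φ) := 
  ⟨fun f g => ⟨fun x k => ∑ l, f.coeff x l * g.coeff (φ l⁻¹ x) (l⁻¹ * k)⟩⟩

theorem coeff_mul (f g : CrossProduct φ) (x : X) (k : K) :
    (f * g).coeff x k = ∑ l, f.coeff x l * g.coeff (φ l⁻¹ x) (l⁻¹ * k) := rfl

instance : Ring (CrossProduct φ) :=
  { (inferInstance : AddCommGroup (CrossProduct φ)),
    (inferInstance : One (CrossProduct φ)),
    (inferInstance : Mul (CrossProduct φ)) with
    left_distrib := by
      intro f g h
      ext x k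
      simp [coeff_mul, mul_add, Finset.sum_add_distrib]
    right_distrib := by
      intro f g h
      ext x k
      simp [coeff_mul, add_mul, Finset.sum_add_distrib]
    zero_mul := by
      intro f
      ext x k
      simp [coeff_mul]
    mul_zero := by
      intro f
      ext x k
      simp [coeff_mul]
    one_mul := by
      intro f
      ext x k
      rw [coeff_mul, Finset.sum_eq_single 1]
      · simp [coeff_one]
      · intro l _ hl
        simp [coeff_one, hl]
      · simp
    mul_one := by
      intro f
      ext x k
      rw [coeff_mul, Finset.sum_eq_single k]
      · simp [coeff_one]
      · intro l _ hl
        simp [coeff_one, inv_mul_eq_one, hl]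
      · simp
    mul_assoc := by
      intro f g h
      ext x k
      simp only [coeff_mul, Finset.sum_mul, Finset.mul_sum]
      rw [Finset.sum_comm]
      refine Finset.sum_congr rfl fun m _ => ?_
      refine Fintype.sum_equiv (Equiv.mulLeft m⁻¹) _ _ fun l => ?_
      have h1 : φ (m⁻¹ * l)⁻¹ (φ m⁻¹ x) = φ l⁻¹ x := by
        rw [← Equiv.Perm.mul_apply, ← map_mul]
        congr 2
        group
      have h2 : (m⁻¹ * l)⁻¹ * (m⁻¹ * k) = l⁻¹ * k := by group
      simp only [Equiv.coe_mulLeft, h1, h2, mul_assoc] }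

instance : Algebra ℂ (CrossProduct φ) :=
  Algebra.ofModule
    (by
      intro c f g
      ext x k
      simp [coeff_mul, Finset.mul_sum, mul_assoc])
    (by
      intro c f g
      ext x k
      simp [coeff_mul, Finset.mul_sum, mul_left_comm])

open scoped Classical in
/-- The basis element `δ_x ⊗ k`. -/
def basis (x : X) (k : K) : CrossProduct φ := ⟨fun y l => if y = x ∧ l = k then 1 else 0⟩

open scoped Classical in
theorem basis_mul_basis (x y : X) (k l : K) :
    (basis x k * basis y l : CrossProduct φ) = if x = φ k y then basis x (k * l) else 0 := by
  have hk : ∀ z : X, φ k⁻¹ z = y ↔ z = φ k y := fun z => by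
    rw [map_inv, Equiv.Perm.inv_eq_iff_eq]
  ext z m
  rw [coeff_mul, Finset.sum_eq_single k]
  · simp only [basis, hk, inv_mul_eq_iff_eq_mul]
    by_cases hz : z = x
    · subst hz
      by_cases hy : z = φ k y
      · simp [← hy]
      · simp [hy]
    · split_ifs <;> simp_all
  · intro b _ hb
    simp [basis, hb]
  · simp

end CrossProduct

/-- The isotropy group of a point. -/
def Isotropy (x : X) : Subgroup K where
  carrier := {k | φ k x = x}
  mul_mem' := by
    intro a b ha hb
    simp only [Set.mem_ofPred_eq] at ha hb ⊢
    rw [map_mul, Equiv.Perm.mul_apply, hb, ha]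
  one_mem' := by simp
  inv_mem' := by
    intro a ha
    simp only [Set.mem_ofPred_eq] at ha ⊢
    rw [map_inv, Equiv.Perm.inv_eq_iff_eq, ha]

/-- The orbit of a point. -/
@[ext]
structure Orbit (x : X) where
  val : X
  exists_eq : ∃ k, φ k x = val

namespace Orbit

variable {φ}

instance [Finite K] (x : X) : Finite (Orbit φ x) :=
  Finite.of_surjective (fun k : K => (⟨φ k x, k, rfl⟩ : Orbit φ x))
    fun y => by
      obtain ⟨y, k, hk⟩ := y
      exact ⟨k, Orbit.ext hk⟩

instance [Finite K] (x : X) : Fintype (Orbit φ x) := Fintype.ofFinite _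

instance (x : X) : MulAction K (Orbit φ x) where
  smul k y := ⟨φ k y.val, by
    obtain ⟨y, l, rfl⟩ := y
    exact ⟨k * l, by simp⟩⟩
  one_smul y := Orbit.ext (by
    change φ 1 y.val = y.val
    simp)
  mul_smul k l y := Orbit.ext (by
    change φ (k * l) y.val = φ k (φ l y.val)
    simp)

theorem smul_val {x : X} (k : K) (y : Orbit φ x) : (k • y).val = φ k y.val := rfl

end Orbit

/-- An orbit with a fixed base point and a choice of a lift: `lift s` carries the base point to
`s`, and the lift of the base point is the identity. -/
structure PointedOrbit where
  base : X
  lift : Orbit φ base → K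
  lift_spec : ∀ s, φ (lift s) base = s.val
  lift_base : lift ⟨base, 1, by simp⟩ = 1

namespace PointedOrbit

variable {φ} (D : PointedOrbit φ)

/-- The points of the orbit. -/
abbrev Points : Type v := Orbit φ D.base

/-- The isotropy group of the base point. -/
abbrev Iso : Subgroup K := Isotropy φ D.base

/-- The cocycle `ζ_s(k) = (lift (k s))⁻¹ k (lift s)`, with values in the isotropy group. -/
def cocycle (s : D.Points) (k : K) : D.Iso :=
  ⟨(D.lift (k • s))⁻¹ * k * D.lift s, by
    change φ ((D.lift (k • s))⁻¹ * k * D.lift s) D.base = D.base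
    rw [map_mul, map_mul, Equiv.Perm.mul_apply, Equiv.Perm.mul_apply, D.lift_spec, map_inv,
      Equiv.Perm.inv_eq_iff_eq, D.lift_spec, Orbit.smul_val]⟩

theorem cocycle_mul (s : D.Points) (k l : K) :
    D.cocycle s (k * l) = D.cocycle (l • s) k * D.cocycle s l := by
  apply Subtype.ext
  simp only [cocycle, mul_smul, Subgroup.coe_mul]
  group

theorem cocycle_one (s : D.Points) : D.cocycle s 1 = 1 := by
  apply Subtype.ext
  simp [cocycle]

/-- Conjugation by the lift of `s`, from the isotropy group of `s` to that of the base point: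
`m ↦ (lift s)⁻¹ m (lift s)`. -/
def conjIso (s : D.Points) : Isotropy φ s.val →* D.Iso where
  toFun m := ⟨(D.lift s)⁻¹ * m.1 * D.lift s, by
    have hm : φ m.1 s.val = s.val := m.2
    change φ ((D.lift s)⁻¹ * m.1 * D.lift s) D.base = D.base
    rw [map_mul, map_mul, Equiv.Perm.mul_apply, Equiv.Perm.mul_apply, D.lift_spec, hm, map_inv,
      Equiv.Perm.inv_eq_iff_eq, D.lift_spec]⟩
  map_one' := by
    apply Subtype.ext
    simp
  map_mul' a b := by
    apply Subtype.ext
    simp only [Subgroup.coe_mul]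
    group

end PointedOrbit

/-- The space `ℂO ⊗ V` attached to an orbit `O` and a representation of the isotropy group on `V`,
an element standing for `∑ s ⊗ coord s`. -/
structure OrbitModule {φ : K →* Equiv.Perm X} (D : PointedOrbit φ) {V : Type w} [AddCommGroup V]
    [Module ℂ V] (ρ : Representation ℂ D.Iso V) where
  coord : D.Points → V

namespace OrbitModule

variable {φ} {D : PointedOrbit φ} {V : Type w} [AddCommGroup V] [Module ℂ V]
  {ρ : Representation ℂ D.Iso V}

@[ext]
theorem ext' {F F' : OrbitModule D ρ} (h : ∀ s, F.coord s = F'.coord s) : F = F' := by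
  obtain ⟨F⟩ := F
  obtain ⟨F'⟩ := F'
  congr
  exact funext h

theorem coord_injective : Function.Injective (coord : OrbitModule D ρ → D.Points → V) :=
  fun _ _ h => ext' fun s => congrFun h s

instance : Zero (OrbitModule D ρ) := ⟨⟨0⟩⟩
instance : Add (OrbitModule D ρ) := ⟨fun F F' => ⟨F.coord + F'.coord⟩⟩
instance : Neg (OrbitModule D ρ) := ⟨fun F => ⟨-F.coord⟩⟩
instance : Sub (OrbitModule D ρ) := ⟨fun F F' => ⟨F.coord - F'.coord⟩⟩
instance : SMul ℕ (OrbitModule D ρ) := ⟨fun c F => ⟨c • F.coord⟩⟩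
instance : SMul ℤ (OrbitModule D ρ) := ⟨fun c F => ⟨c • F.coord⟩⟩
instance : SMul ℂ (OrbitModule D ρ) := ⟨fun c F => ⟨c • F.coord⟩⟩

instance : AddCommGroup (OrbitModule D ρ) :=
  coord_injective.addCommGroup _ rfl (fun _ _ => rfl) (fun _ => rfl) (fun _ _ => rfl)
    (fun _ _ => rfl) (fun _ _ => rfl)

/-- The components, as an additive map. -/
def coordHom : OrbitModule D ρ →+ (D.Points → V) where
  toFun := coord
  map_zero' := rfl
  map_add' _ _ := rfl

instance : Module ℂ (OrbitModule D ρ) := coord_injective.module ℂ coordHom (fun _ _ => rfl)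

@[simp] theorem coord_add (F F' : OrbitModule D ρ) (s : D.Points) :
    (F + F').coord s = F.coord s + F'.coord s := rfl

@[simp] theorem coord_zero (s : D.Points) : (0 : OrbitModule D ρ).coord s = 0 := rfl

@[simp] theorem coord_complex_smul (c : ℂ) (F : OrbitModule D ρ) (s : D.Points) :
    (c • F).coord s = c • F.coord s := rfl

variable [Fintype K]

instance : SMul (CrossProduct φ) (OrbitModule D ρ) :=
  ⟨fun f F =>
    ⟨fun s => ∑ k : K, f.coeff s.val k • ρ (D.cocycle (k⁻¹ • s) k) (F.coord (k⁻¹ • s))⟩⟩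

theorem coord_smul (f : CrossProduct φ) (F : OrbitModule D ρ) (s : D.Points) :
    (f • F).coord s
      = ∑ k : K, f.coeff s.val k • ρ (D.cocycle (k⁻¹ • s) k) (F.coord (k⁻¹ • s)) := rfl

instance : Module (CrossProduct φ) (OrbitModule D ρ) where
  smul_add f F F' := by
    ext s
    simp [coord_smul, Finset.sum_add_distrib]
  smul_zero f := by
    ext s
    simp [coord_smul]
  add_smul f g F := by
    ext s
    simp [coord_smul, add_smul, Finset.sum_add_distrib]
  zero_smul F := by
    ext s
    simp [coord_smul]
  one_smul F := by
    ext s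
    classical
    rw [coord_smul, Finset.sum_eq_single 1]
    · simp [CrossProduct.coeff_one, PointedOrbit.cocycle_one]
    · intro k _ hk
      simp [CrossProduct.coeff_one, hk]
    · simp
  mul_smul f g F := by
    ext s
    simp only [coord_smul, CrossProduct.coeff_mul, Finset.sum_smul, map_sum, Finset.smul_sum,
      map_smul]
    rw [Finset.sum_comm]
    refine Finset.sum_congr rfl fun m _ => ?_
    refine Fintype.sum_equiv (Equiv.mulLeft m⁻¹) _ _ fun k => ?_
    have h1 : (m⁻¹ * k)⁻¹ • m⁻¹ • s = k⁻¹ • s := by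
      rw [← mul_smul]
      congr 1
      group
    have h2 : D.cocycle (k⁻¹ • s) k
        = D.cocycle (m⁻¹ • s) m * D.cocycle (k⁻¹ • s) (m⁻¹ * k) := by
      have := D.cocycle_mul (k⁻¹ • s) m (m⁻¹ * k)
      rwa [mul_inv_cancel_left, ← mul_smul (m⁻¹ * k) k⁻¹ s, mul_inv_cancel_right] at this
    simp only [Equiv.coe_mulLeft, h1, h2, map_mul, Module.End.mul_apply, Orbit.smul_val, mul_smul]

instance : IsScalarTower ℂ (CrossProduct φ) (OrbitModule D ρ) where
  smul_assoc c f F := by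
    ext s
    simp [coord_smul, Finset.smul_sum, mul_smul]

open scoped Classical in
/-- The element `s ⊗ v`. -/
def tensor (s : D.Points) (v : V) : OrbitModule D ρ :=
  ⟨fun t => if t = s then v else 0⟩

open scoped Classical in
/-- The action: `δ_x` projects to the component of `x`, and `k (s ⊗ v) = k s ⊗ ζ_s(k) v`. -/
theorem basis_smul_tensor (x : X) (k : K) (s : D.Points) (v : V) :
    (CrossProduct.basis x k : CrossProduct φ) • (tensor s v : OrbitModule D ρ)
      = if x = φ k s.val then tensor (k • s) (ρ (D.cocycle s k) v) else 0 := by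
  ext t
  rw [coord_smul, Finset.sum_eq_single k]
  · by_cases hts : k⁻¹ • t = s
    · have ht : t = k • s := by rw [← hts, smul_inv_smul]
      subst ht
      simp only [CrossProduct.basis, tensor, inv_smul_smul, Orbit.smul_val, and_true, if_true]
      by_cases hx : x = φ k s.val
      · simp [hx]
      · rw [if_neg hx, if_neg (fun h => hx h.symm)]
        simp
    · have ht : ¬ t = k • s := fun h => hts (by rw [h, inv_smul_smul])
      split_ifs <;> simp [tensor, hts, ht]
  · intro b _ hb
    simp [CrossProduct.basis, hb]
  · simp

end OrbitModule

end CrossProduct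

/-! ### The quantum double and the boundary algebra -/

section Algebras

variable {G : Type u} [Group G]

/-- The action of `G` on itself by conjugation. -/
def conjAction (G : Type u) [Group G] : G →* Equiv.Perm G := (MulAut.toPerm G).comp MulAut.conj

theorem conjAction_apply (h g : G) : conjAction G h g = h * g * h⁻¹ := rfl

/-- The quantum double `D(G)`: the cross product of `ℂ(G)` and `ℂG` with
`h δ_g = δ_{h g h⁻¹} h`. -/
abbrev QuantumDouble (G : Type u) [Group G] : Type u := CrossProduct (conjAction G)

/-- A set of representatives, containing the identity, of the left cosets `gK`: every element of
`G` is uniquely of the form `r x` with `r` in the set and `x ∈ K`. -/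
structure Transversal (K : Subgroup G) where
  carrier : Set G
  isComplement : Subgroup.IsComplement carrier (K : Set G)
  one_mem : (1 : G) ∈ carrier

namespace Transversal

variable {K : Subgroup G} (R : Transversal K)

/-- The representative of the coset `gK`. -/
def proj (g : G) : R.carrier := R.isComplement.toLeftFun g

theorem proj_mem (g : G) : ((R.proj g : G))⁻¹ * g ∈ K := R.isComplement.inv_toLeftFun_mul_mem g

theorem proj_eq {g : G} {r : R.carrier} (h : (r : G)⁻¹ * g ∈ K) : R.proj g = r :=
  (Subgroup.isComplement_iff_existsUnique_inv_mul_mem.1 R.isComplement g).unique (R.proj_mem g) h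

theorem proj_val (r : R.carrier) : R.proj (r : G) = r := R.proj_eq (by simp)

theorem proj_eq_proj {g g' : G} (h : g⁻¹ * g' ∈ K) : R.proj g' = R.proj g :=
  R.proj_eq (by simpa [mul_assoc] using K.mul_mem (R.proj_mem g) h)

theorem proj_mul_proj (a g : G) : R.proj (a * (R.proj g : G)) = R.proj (a * g) := by
  refine R.proj_eq_proj ?_
  have h := K.inv_mem (R.proj_mem g)
  simpa [mul_assoc] using h

/-- The action of `K` on the transversal: `x ▷ r` is the representative of the coset `x r K`. -/
def action : K →* Equiv.Perm R.carrier where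
  toFun a :=
    { toFun := fun r => R.proj (a * r)
      invFun := fun r => R.proj ((a : G)⁻¹ * r)
      left_inv := fun r => by simp [proj_mul_proj, proj_val]
      right_inv := fun r => by simp [proj_mul_proj, proj_val] }
  map_one' := by
    ext r
    simp [proj_val]
  map_mul' a b := by
    ext r
    simp [proj_mul_proj, mul_assoc]

theorem action_apply (a : K) (r : R.carrier) : R.action a r = R.proj (a * r) := rfl

/-- The algebra `Ξ(R,K)`: the cross product of `ℂ(R)` and `ℂK` with `x δ_r = δ_{x ▷ r} x`. -/
abbrev Xi : Type u := CrossProduct R.action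

variable [Fintype G] [Fintype K]

open scoped Classical in
/-- The inclusion of algebras `Ξ(R,K) → D(G)`, given by `x ↦ x` and `δ_r ↦ ∑_{y ∈ K} δ_{r y}`. -/
def inclusion : R.Xi →ₐ[ℂ] QuantumDouble G :=
  AlgHom.ofLinearMap
    { toFun := fun f => ⟨fun g h => if hh : h ∈ K then f.coeff (R.proj g) ⟨h, hh⟩ else 0⟩
      map_add' := by
        intro f f'
        ext g h
        by_cases hh : h ∈ K <;> simp [hh]
      map_smul' := by
        intro c f
        ext g h
        by_cases hh : h ∈ K <;> simp [hh] }
    (by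
      ext g h
      by_cases hh : h ∈ K
      · simp [CrossProduct.coeff_one, hh]
      · have : h ≠ 1 := fun h1 => hh (h1 ▸ K.one_mem)
        simp [CrossProduct.coeff_one, hh, this])
    (by
      intro f f'
      ext g h
      simp only [LinearMap.coe_mk, AddHom.coe_mk, CrossProduct.coeff_mul]
      have key : ∀ l : K, R.action l⁻¹ (R.proj g) = R.proj (conjAction G (l : G)⁻¹ g) := by
        intro l
        rw [action_apply, proj_mul_proj, conjAction_apply]
        refine R.proj_eq_proj ?_
        simp [mul_assoc]
      rw [← Finset.sum_subset (Finset.subset_univ (Finset.univ.filter (· ∈ K)))]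
      · by_cases hh : h ∈ K
        · rw [dif_pos hh]
          refine Finset.sum_bij (fun l _ => (l : G)) ?_ ?_ ?_ ?_
          · intro l _
            simp
          · intro a _ b _ hab
            exact Subtype.ext hab
          · intro b hb
            exact ⟨⟨b, by simpa using hb⟩, Finset.mem_univ _, rfl⟩
          · intro l _
            have hl : (l : G)⁻¹ * h ∈ K := K.mul_mem (K.inv_mem l.2) hh
            rw [dif_pos l.2, dif_pos hl, key]
            rfl
        · rw [dif_neg hh]
          refine (Finset.sum_eq_zero fun l hl => ?_).symm
          have hl' : l ∈ K := by simpa using hl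
          have : ¬ l⁻¹ * h ∈ K := fun h' => hh (by simpa using K.mul_mem hl' h')
          rw [dif_neg this, mul_zero]
      · intro l _ hl
        have : ¬ l ∈ K := by simpa using hl
        rw [dif_neg this, zero_mul])

theorem inclusion_basis (r : R.carrier) (a : K) :
    R.inclusion (CrossProduct.basis r a)
      = ∑ y : K, (CrossProduct.basis ((r : G) * y) (a : G) : QuantumDouble G) := by
  classical
  ext g h
  rw [CrossProduct.coeff_sum]
  change (if hh : h ∈ K then (CrossProduct.basis r a : R.Xi).coeff (R.proj g) ⟨h, hh⟩ else 0) = _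
  by_cases hh : h = a
  · subst hh
    rw [dif_pos a.2]
    by_cases hr : R.proj g = r
    · have hg : (r : G)⁻¹ * g ∈ K := hr ▸ R.proj_mem g
      rw [Finset.sum_eq_single ⟨(r : G)⁻¹ * g, hg⟩]
      · simp [CrossProduct.basis, hr]
      · intro b _ hb
        have : ¬ g = (r : G) * b := fun h => hb (Subtype.ext (by simp [h]))
        simp [CrossProduct.basis, this]
      · simp
    · rw [Finset.sum_eq_zero]
      · simp [CrossProduct.basis, hr]
      · intro b _
        have : ¬ g = (r : G) * b := fun h => hr (R.proj_eq (by simp [h]))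
        simp [CrossProduct.basis, this]
  · rw [Finset.sum_eq_zero]
    · by_cases hK : h ∈ K
      · have : ¬ (⟨h, hK⟩ : K) = a := fun h' => hh (congrArg Subtype.val h')
        simp [CrossProduct.basis, this]
      · simp [hK]
    · intro b _
      simp [CrossProduct.basis, hh]

theorem inclusion_injective : Function.Injective R.inclusion := by
  classical
  intro f f' h
  ext r a
  have := congrArg (fun F : QuantumDouble G => F.coeff (r : G) (a : G)) h
  change (if hh : (a : G) ∈ K then f.coeff (R.proj r) ⟨a, hh⟩ else 0)
    = (if hh : (a : G) ∈ K then f'.coeff (R.proj r) ⟨a, hh⟩ else 0) at this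
  simpa [proj_val] using this

end Transversal

/-- The group `K^{r,c} = K^r ∩ G^c` of all `x ∈ K` with `x ▷ r = r` and `x c x⁻¹ = c`. -/
def JointIsotropy {K : Subgroup G} (R : Transversal K) (r : R.carrier) (c : G) : Subgroup K :=
  Isotropy R.action r ⊓ (Isotropy (conjAction G) c).comap K.subtype

namespace JointIsotropy

variable {K : Subgroup G} (R : Transversal K) (r : R.carrier) (c : G)

/-- The inclusion of `K^{r,c}` in `K^r`. -/
def toLeft : JointIsotropy R r c →* Isotropy R.action r := Subgroup.inclusion inf_le_left

/-- The inclusion of `K^{r,c}` in `G^c`. -/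
def toRight : JointIsotropy R r c →* Isotropy (conjAction G) c :=
  (K.subtype.comp (JointIsotropy R r c).subtype).codRestrict _ fun m => m.2.2

end JointIsotropy

end Algebras

/-! ### Irreducible representations of a finite group -/

section Irreps

variable (H : Type u) [Group H]

/-- An irreducible complex representation on some `ℂⁿ`. -/
structure MatrixIrrep where
  n : ℕ
  rep : Representation ℂ H (Fin n → ℂ)
  irreducible : rep.IsIrreducible

/-- Isomorphism of irreducible representations. -/
instance MatrixIrrep.setoid : Setoid (MatrixIrrep H) where
  r σ τ := Nonempty (σ.rep.Equiv τ.rep)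
  iseqv :=
    { refl := fun _ => ⟨Representation.Equiv.refl _⟩
      symm := fun ⟨e⟩ => ⟨e.symm⟩
      trans := fun ⟨e⟩ ⟨e'⟩ => ⟨e.trans e'⟩ }

/-- The set of isomorphism classes of irreducible complex representations of `H`. -/
abbrev Irr : Type u := Quotient (MatrixIrrep.setoid H)

namespace Irr

variable {H}

/-- A representation in the class `τ`. -/
def rep (τ : Irr H) : Representation ℂ H (Fin (Quotient.out τ).n → ℂ) := (Quotient.out τ).rep

instance (τ : Irr H) : τ.rep.IsIrreducible := (Quotient.out τ).irreducible

theorem eq_of_equiv {σ τ : Irr H} (h : Nonempty (σ.rep.Equiv τ.rep)) : σ = τ := by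
  rw [← Quotient.out_eq σ, ← Quotient.out_eq τ]
  exact Quotient.sound h

instance [Finite H] : Finite (Irr H) := by
  classical
  have := Fintype.ofFinite H
  have : Invertible (Nat.card H : ℂ) := invertibleOfNonzero (by simp)
  have key : ∀ σ τ : Irr H, (Nat.card H : ℂ)⁻¹ * ∑ g : H, σ.rep.character g * τ.rep.character g⁻¹
      = if σ = τ then 1 else 0 := by
    intro σ τ
    rw [Representation.char_orthonormal]
    by_cases h : σ = τ
    · subst h
      simp [show Nonempty (σ.rep.Equiv σ.rep) from ⟨Representation.Equiv.refl _⟩]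
    · rw [if_neg h, if_neg]
      exact fun ⟨e⟩ => h (eq_of_equiv ⟨e.symm⟩)
  have hli : LinearIndependent ℂ (fun τ : Irr H => (τ.rep.character : H → ℂ)) := by
    rw [linearIndependent_iff']
    intro s a ha τ hτ
    have h0 : ∑ g : H, (∑ σ ∈ s, a σ • (σ.rep.character : H → ℂ)) g * τ.rep.character g⁻¹ = 0 := by
      rw [ha]
      simp
    simp only [Finset.sum_apply, Pi.smul_apply, smul_eq_mul, Finset.sum_mul] at h0
    rw [Finset.sum_comm] at h0
    have h1 : ∑ σ ∈ s, a σ * ((Nat.card H : ℂ)⁻¹ *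
        ∑ g : H, σ.rep.character g * τ.rep.character g⁻¹) = 0 := by
      have h2 : ∀ σ ∈ s, a σ * ((Nat.card H : ℂ)⁻¹ *
          ∑ g : H, σ.rep.character g * τ.rep.character g⁻¹)
          = (Nat.card H : ℂ)⁻¹ * ∑ g : H, a σ * σ.rep.character g * τ.rep.character g⁻¹ := by
        intro σ _
        simp only [Finset.mul_sum]
        refine Finset.sum_congr rfl fun g _ => ?_
        ring
      rw [Finset.sum_congr rfl h2, ← Finset.mul_sum, h0, mul_zero]
    simp only [key] at h1
    simpa [hτ] using h1
  exact hli.finite_of_isNoetherian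

instance [Finite H] : Fintype (Irr H) := Fintype.ofFinite _

end Irr

variable {H}

/-- The multiplicity of the irreducible representation `τ` in the representation `σ`. -/
def branching (τ : Irr H) {V : Type w} [AddCommGroup V] [Module ℂ V] (σ : Representation ℂ H V) :
    ℕ :=
  multiplicity (MonoidAlgebra ℂ H) τ.rep.asModule σ.asModule

end Irreps

end KitaevBoundary

end

open KitaevBoundary

open scoped TensorProduct

noncomputable section

namespace KitaevBoundary

universe u v w

/-! ### Isotypic decomposition and traces -/

section Multiplicity

variable {A : Type u} [Ring A] [Algebra ℂ A]
variable {V : Type v} [AddCommGroup V] [Module A V]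
variable {M : Type w} [AddCommGroup M] [Module ℂ M] [Module A M] [IsScalarTower ℂ A M]

/-! Both algebras are cross products of `ℂ(X)` with `ℂK` for a finite group `K` acting on a finite
set `X`, and for these Maschke's argument works: averaging a linear map against the elements `δ_x ⊗
k` and `δ_{k⁻¹x} ⊗ k⁻¹` projects onto the module maps (`isProj_average`). Hence finite-dimensional
modules are semisimple, and the trace of the projection expresses `dim Hom` as a scalar product of
characters (`finrank_hom`), which is symmetric in the two modules.

The orbit modules are simple, so each multiplicity is the dimension of a space of maps out of the
simple module. Frobenius reciprocity (`finrank_induction_hom`) together with the symmetry of `dim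
Hom` identifies the two multiplicities.

For the formula, `δ_r ⊗ k` has a trace on an orbit module only from points fixed by `k`, and on the
restriction `i^*(W)` only from those `c` with `r⁻¹c ∈ K`. What remains, for each pair `(r, c)`, is
the character sum of `ρ̃` and `π̃` over `K^{r,c}`, equal to `|K^{r,c}| ∑ n_τ n_τ`. By
orbit-stabilizer for both orbits, the prefactor is just `1/|K|`. -/

theorem exists_hasMultiplicity [FiniteDimensional ℂ M] [IsSimpleModule A V]
    [IsSemisimpleModule A M] : ∃ n, HasMultiplicity A V M n := by
  obtain ⟨N, hN⟩ := exists_isCompl (isotypicComponent A M V)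
  have : Module.Finite A (isotypicComponent A M V) := by
    have : FiniteDimensional ℂ (isotypicComponent A M V) :=
      inferInstanceAs (FiniteDimensional ℂ ((isotypicComponent A M V).restrictScalars ℂ))
    exact Module.Finite.of_restrictScalars_finite ℂ A _
  obtain ⟨n, e⟩ := (IsIsotypicOfType.isotypicComponent A M V).linearEquiv_fun
  refine ⟨n, _, N, hN, e, fun f => ?_⟩
  -- An injective `f` would give a copy of `V` in `N`; every copy lies in the isotypic component,
  -- which meets `N` only in `0`.
  refine (LinearMap.injective_or_eq_zero f).resolve_left fun hf => ?_
  have hg : Function.Injective (N.subtype ∘ₗ f) := N.injective_subtype.comp hf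
  have hle : LinearMap.range (N.subtype ∘ₗ f) ≤ isotypicComponent A M V :=
    le_sSup ⟨(LinearEquiv.ofInjective _ hg).symm⟩
  have := IsSimpleModule.nontrivial A V
  obtain ⟨v, hv⟩ := exists_ne (0 : V)
  have h0 := (Submodule.disjoint_def.1 hN.disjoint) (f v) (hle ⟨v, rfl⟩) (f v).2
  exact hv (hf (by simpa using h0))

theorem hasMultiplicity_finrank [Module ℂ V] [IsScalarTower ℂ A V] [FiniteDimensional ℂ V]
    [FiniteDimensional ℂ M]
    [IsSimpleModule A V] [IsSemisimpleModule A M] :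
    HasMultiplicity A V M (Module.finrank ℂ (V →ₗ[A] M)) := by
  obtain ⟨n, hn⟩ := exists_hasMultiplicity (A := A) (V := V) (M := M)
  have := hn.multiplicity_eq
  rw [multiplicity] at this
  rwa [this]

end Multiplicity

section Trace

/-- Split `f` along the coordinates and move each projection cyclically around the trace: only the
diagonal blocks survive. -/
theorem trace_pi {ι : Type*} [Fintype ι] [DecidableEq ι] {E : Type*} [AddCommGroup E] [Module ℂ E]
    [FiniteDimensional ℂ E] (f : (ι → E) →ₗ[ℂ] (ι → E)) :
    LinearMap.trace ℂ _ f
      = ∑ i, LinearMap.trace ℂ E (LinearMap.proj i ∘ₗ f ∘ₗ LinearMap.single ℂ (fun _ => E) i) := by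
  have hid : f = ∑ i, (f ∘ₗ LinearMap.single ℂ (fun _ => E) i) ∘ₗ LinearMap.proj i := by
    ext1 i
    ext v j
    simp only [LinearMap.comp_apply, LinearMap.sum_apply, LinearMap.single_apply,
      LinearMap.proj_apply]
    rw [← map_sum, Finset.univ_sum_single]
  conv_lhs => rw [hid]
  rw [map_sum]
  exact Finset.sum_congr rfl fun i _ => LinearMap.trace_comp_comm' _ _

/-- Under `Hom(M, N) ≅ M* ⊗ N` the map `f ↦ a f b` becomes `bᵗ ⊗ a`. This turns the trace of the
averaging projection into products of characters. -/
theorem trace_comp_left_right {M N : Type*} [AddCommGroup M] [Module ℂ M] [AddCommGroup N]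
    [Module ℂ N] [FiniteDimensional ℂ M] [FiniteDimensional ℂ N] (a : N →ₗ[ℂ] N) (b : M →ₗ[ℂ] M) :
    LinearMap.trace ℂ (M →ₗ[ℂ] N) (LinearMap.llcomp ℂ M N N a ∘ₗ LinearMap.lcomp ℂ N b)
      = LinearMap.trace ℂ N a * LinearMap.trace ℂ M b := by
  have h : LinearMap.llcomp ℂ M N N a ∘ₗ LinearMap.lcomp ℂ N b
      = (dualTensorHomEquiv ℂ M N).conj (TensorProduct.map (Module.Dual.transpose (R := ℂ) b) a) := by
    rw [LinearEquiv.conj_apply, LinearEquiv.eq_comp_toLinearMap_symm]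
    ext φ n m
    simp [dualTensorHomEquiv]
    rfl
  rw [h, LinearMap.trace_conj', LinearMap.trace_tensorProduct', LinearMap.trace_transpose',
    mul_comm]

end Trace

/-! ### Averaging over a cross product algebra -/

namespace CrossProduct

variable {K : Type*} [Group K] {X : Type*} {φ : K →* Equiv.Perm X}

instance [Finite K] [Finite X] : FiniteDimensional ℂ (CrossProduct φ) :=
  Module.Finite.of_injective
    ({ toFun := coeff, map_add' := fun _ _ => rfl, map_smul' := fun _ _ => rfl } :
      CrossProduct φ →ₗ[ℂ] X → K → ℂ) coeff_injective

variable [Fintype K] [Fintype X]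

theorem eq_sum_basis (f : CrossProduct φ) : f = ∑ x, ∑ k, f.coeff x k • basis x k := by
  classical
  ext x k
  simp only [coeff_sum, coeff_smul, basis]
  rw [Finset.sum_eq_single x, Finset.sum_eq_single k]
  · simp
  · intro l _ hl
    simp [Ne.symm hl]
  · simp
  · intro y _ hy
    simp [Ne.symm hy]
  · simp

theorem sum_basis_one : ∑ x, (basis x 1 : CrossProduct φ) = 1 := by
  classical
  ext x k
  rw [coeff_sum, coeff_one, Finset.sum_eq_single x]
  · simp [basis]
  · intro y _ hy
    simp [basis, Ne.symm hy]
  · simp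

variable {M : Type*} [AddCommGroup M] [Module ℂ M] [Module (CrossProduct φ) M]
  [IsScalarTower ℂ (CrossProduct φ) M]
  {N : Type*} [AddCommGroup N] [Module ℂ N] [Module (CrossProduct φ) N]
  [IsScalarTower ℂ (CrossProduct φ) N]

/-- A `ℂ`-linear map that commutes with the basis elements is linear over the cross product. -/
def linearMapOfBasis (f : M →ₗ[ℂ] N)
    (h : ∀ x k m, f ((basis x k : CrossProduct φ) • m) = (basis x k : CrossProduct φ) • f m) :
    M →ₗ[CrossProduct φ] N where
  toFun := f
  map_add' := map_add f
  map_smul' a m := by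
    rw [eq_sum_basis a]
    simp only [Finset.sum_smul, map_sum, smul_assoc, map_smul, h, RingHom.id_apply]

variable (φ M N) in
/-- The projection `f ↦ |K|⁻¹ ∑ (δ_x ⊗ k) f (δ_{k⁻¹ x} ⊗ k⁻¹)` of the linear maps to the module
maps. -/
def average : (M →ₗ[ℂ] N) →ₗ[ℂ] (M →ₗ[ℂ] N) :=
  (Nat.card K : ℂ)⁻¹ • ∑ x : X, ∑ k : K,
    LinearMap.llcomp ℂ M N N (Algebra.lsmul ℂ ℂ N (basis x k : CrossProduct φ)) ∘ₗ
      LinearMap.lcomp ℂ N (Algebra.lsmul ℂ ℂ M (basis (φ k⁻¹ x) k⁻¹ : CrossProduct φ))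

theorem average_apply (f : M →ₗ[ℂ] N) (m : M) :
    average φ M N f m = (Nat.card K : ℂ)⁻¹ • ∑ x : X, ∑ k : K,
      (basis x k : CrossProduct φ) • f ((basis (φ k⁻¹ x) k⁻¹ : CrossProduct φ) • m) := by
  simp [average]

/-- A single point survives in each sum over `X`: `x = y` on the left and `x = l⁻¹y` on the right.
The two sums over `K` then agree after the substitution `k ↦ l k`. -/
theorem average_basis_smul (f : M →ₗ[ℂ] N) (y : X) (l : K) (m : M) :
    average φ M N f ((basis y l : CrossProduct φ) • m)
      = (basis y l : CrossProduct φ) • average φ M N f m := by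
  classical
  rw [average_apply, average_apply, smul_comm (basis y l : CrossProduct φ)]
  congr 1
  simp only [Finset.smul_sum, smul_smul, basis_mul_basis]
  rw [Finset.sum_eq_single y, Finset.sum_eq_single (φ l⁻¹ y)]
  · refine (Fintype.sum_equiv (Equiv.mulLeft l) _ _ fun k => ?_).symm
    simp
  · intro x _ hx
    refine Finset.sum_eq_zero fun k _ => ?_
    rw [if_neg, zero_smul]
    rintro rfl
    simp at hx
  · simp
  · intro x _ hx
    refine Finset.sum_eq_zero fun k _ => ?_
    rw [if_neg, zero_smul, map_zero, smul_zero]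
    exact fun h => hx ((φ k⁻¹).injective h)
  · simp

/-- The product of `δ_x ⊗ k` and `δ_{k⁻¹x} ⊗ k⁻¹` is `δ_x ⊗ 1`, and these sum to `|K|` times the
identity. The hypothesis concerns one vector `m` only, so that the lemma also applies to a
retraction that is equivariant merely on a submodule. -/
theorem average_eq_self (f : M →ₗ[ℂ] N) (m : M)
    (h : ∀ (x : X) (k : K), f ((basis x k : CrossProduct φ) • m)
      = (basis x k : CrossProduct φ) • f m) : average φ M N f m = f m := by
  classical
  have h1 : ∀ (x : X) (k : K), (basis x k : CrossProduct φ) •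
      f ((basis (φ k⁻¹ x) k⁻¹ : CrossProduct φ) • m) = (basis x 1 : CrossProduct φ) • f m := by
    intro x k
    rw [h, smul_smul, basis_mul_basis]
    simp
  rw [average_apply]
  simp only [h1, Finset.sum_const, Finset.card_univ, Fintype.card_eq_nat_card]
  rw [← Finset.smul_sum, ← Finset.sum_smul, sum_basis_one, one_smul, ← Nat.cast_smul_eq_nsmul ℂ,
    smul_smul, inv_mul_cancel₀ (by simp), one_smul]

theorem isProj_average : LinearMap.IsProj
    (LinearMap.range (LinearMap.restrictScalarsₗ ℂ (CrossProduct φ) M N ℂ)) (average φ M N) where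
  map_mem f := ⟨linearMapOfBasis _ (average_basis_smul f), rfl⟩
  map_id := by
    rintro _ ⟨f, rfl⟩
    ext m
    exact average_eq_self _ _ fun x k => map_smul f _ _

/-- The dimension of the space of module maps is the scalar product of the characters. -/
theorem finrank_hom [FiniteDimensional ℂ M] [FiniteDimensional ℂ N] :
    (Module.finrank ℂ (M →ₗ[CrossProduct φ] N) : ℂ) = (Nat.card K : ℂ)⁻¹ * ∑ x : X, ∑ k : K,
      LinearMap.trace ℂ N (Algebra.lsmul ℂ ℂ N (basis x k : CrossProduct φ)) *
        LinearMap.trace ℂ M (Algebra.lsmul ℂ ℂ M (basis (φ k⁻¹ x) k⁻¹ : CrossProduct φ)) := by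
  have h := (isProj_average (φ := φ) (M := M) (N := N)).trace
  rw [LinearMap.finrank_range_of_inj (LinearMap.restrictScalars_injective _)] at h
  rw [← h, average]
  simp only [map_smul, map_sum, trace_comp_left_right, smul_eq_mul]

/-- The substitution `(x, k) ↦ (k⁻¹x, k⁻¹)` exchanges the two characters in `finrank_hom`. -/
theorem finrank_hom_comm [FiniteDimensional ℂ M] [FiniteDimensional ℂ N] :
    Module.finrank ℂ (M →ₗ[CrossProduct φ] N) = Module.finrank ℂ (N →ₗ[CrossProduct φ] M) := by
  refine Nat.cast_injective (R := ℂ) ?_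
  rw [finrank_hom, finrank_hom, Finset.sum_comm, Finset.sum_comm (γ := X)]
  congr 1
  refine Fintype.sum_equiv (Equiv.inv K) _ _ fun k => ?_
  refine Fintype.sum_equiv (φ k⁻¹) _ _ fun x => ?_
  simp [mul_comm]

/-- Averaging a linear retraction onto a submodule gives an equivariant one, whose kernel is a
complement. -/
theorem isSemisimpleModule : IsSemisimpleModule (CrossProduct φ) M := by
  rw [isSemisimpleModule_iff]
  refine ⟨fun p => ?_⟩
  obtain ⟨f, hf⟩ := (p.restrictScalars ℂ).subtype.exists_leftInverse_of_injective
    (LinearMap.ker_eq_bot.2 (p.restrictScalars ℂ).injective_subtype)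
  let g : M →ₗ[ℂ] p := f
  have hg : ∀ m : p, g m = m := fun m => LinearMap.congr_fun hf m
  refine ⟨_, LinearMap.isCompl_of_proj (f := linearMapOfBasis _ (average_basis_smul g))
    fun m => ?_⟩
  refine (average_eq_self g (m : M) fun x k => ?_).trans (hg m)
  rw [← Submodule.coe_smul, hg, hg]

end CrossProduct

/-! ### Orbit modules -/

namespace OrbitModule

variable {K : Type*} [Group K] {X : Type*} {φ : K →* Equiv.Perm X} {D : PointedOrbit φ}
  {V : Type*} [AddCommGroup V] [Module ℂ V] {ρ : Representation ℂ D.Iso V}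

variable (D ρ) in
/-- The components, as a linear equivalence. -/
def coordEquiv : OrbitModule D ρ ≃ₗ[ℂ] (D.Points → V) where
  toFun := coord
  invFun := mk
  map_add' _ _ := rfl
  map_smul' _ _ := rfl

instance [Finite K] [FiniteDimensional ℂ V] : FiniteDimensional ℂ (OrbitModule D ρ) :=
  Module.Finite.equiv (coordEquiv D ρ).symm

variable [Fintype K]

theorem eq_sum_tensor (F : OrbitModule D ρ) : F = ∑ s, tensor s (F.coord s) := by
  classical
  apply (coordEquiv D ρ).injective
  ext s
  rw [map_sum, Finset.sum_apply, Finset.sum_eq_single s]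
  · simp [coordEquiv, tensor]
  · intro t _ ht
    simp [coordEquiv, tensor, Ne.symm ht]
  · simp

theorem basis_one_smul (F : OrbitModule D ρ) (s : D.Points) :
    (CrossProduct.basis s.val 1 : CrossProduct φ) • F = tensor s (F.coord s) := by
  classical
  ext t
  rw [coord_smul, Finset.sum_eq_single 1]
  · by_cases h : t = s
    · subst h
      simp [CrossProduct.basis, tensor, PointedOrbit.cocycle_one]
    · have : ¬ t.val = s.val := fun h' => h (Orbit.ext h')
      simp [CrossProduct.basis, tensor, h, this]
  · intro k _ hk
    simp [CrossProduct.basis, hk]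
  · simp

theorem smul_tensor (k : K) (s : D.Points) (v : V) :
    (CrossProduct.basis (φ k s.val) k : CrossProduct φ) • (tensor s v : OrbitModule D ρ)
      = tensor (k • s) (ρ (D.cocycle s k) v) := by
  rw [basis_smul_tensor, if_pos rfl]

/-- The vectors `v` for which `o ⊗ v` lies in a given submodule, where `o` is the base point. -/
def baseSubrepresentation (N : Submodule (CrossProduct φ) (OrbitModule D ρ)) :
    Subrepresentation ρ where
  toSubmodule :=
    { carrier := {v | (tensor ⟨D.base, 1, by simp⟩ v : OrbitModule D ρ) ∈ N}
      add_mem' := fun {v w} hv hw => by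
        have : (tensor ⟨D.base, 1, by simp⟩ (v + w) : OrbitModule D ρ)
            = tensor ⟨D.base, 1, by simp⟩ v + tensor ⟨D.base, 1, by simp⟩ w := by
          ext t
          simp only [tensor, coord_add]
          split_ifs <;> simp
        rw [Set.mem_ofPred_eq, this]
        exact N.add_mem hv hw
      zero_mem' := by
        have : (tensor ⟨D.base, 1, by simp⟩ 0 : OrbitModule D ρ) = 0 := by
          ext t
          simp [tensor]
        rw [Set.mem_ofPred_eq, this]
        exact N.zero_mem
      smul_mem' := fun c v hv => by
        have : (tensor ⟨D.base, 1, by simp⟩ (c • v) : OrbitModule D ρ)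
            = c • tensor ⟨D.base, 1, by simp⟩ v := by
          ext t
          simp [tensor]
        rw [Set.mem_ofPred_eq, this]
        exact N.smul_of_tower_mem c hv }
  apply_mem_toSubmodule g v hv := by
    have h := N.smul_mem (CrossProduct.basis (φ g.1 D.base) g.1) hv
    rw [smul_tensor g.1 ⟨D.base, 1, by simp⟩ v] at h
    have h1 : (g.1 • ⟨D.base, 1, by simp⟩ : D.Points) = ⟨D.base, 1, by simp⟩ := Orbit.ext g.2
    -- The normalization of the lift at the base point makes the cocycle there the identity on the
    -- isotropy group.
    have h2 : D.cocycle ⟨D.base, 1, by simp⟩ g.1 = g := by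
      apply Subtype.ext
      simp [PointedOrbit.cocycle, h1, D.lift_base]
    rwa [h1, h2] at h

/-- In a nonzero submodule, some `δ_s` isolates a nonzero component, and the inverse lift of `s`
carries it to the base point. The base vectors of the submodule thus form a nonzero
subrepresentation, hence all of `V`, and the lifts spread them over the whole orbit. -/
theorem isSimpleModule (hρ : ρ.IsIrreducible) :
    IsSimpleModule (CrossProduct φ) (OrbitModule D ρ) := by
  have hn : Nontrivial V := by
    by_contra h
    rw [not_nontrivial_iff_subsingleton] at h
    obtain ⟨a, b, hab⟩ := hρ.toNontrivial
    exact hab (SetLike.ext fun x => by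
      rw [Subsingleton.elim x 0]
      exact iff_of_true a.toSubmodule.zero_mem b.toSubmodule.zero_mem)
  rw [isSimpleModule_iff]
  refine { exists_pair_ne := ⟨⊥, ⊤, fun h => ?_⟩, eq_bot_or_eq_top := fun N => ?_ }
  · obtain ⟨v, hv⟩ := exists_ne (0 : V)
    have h0 : (tensor ⟨D.base, 1, by simp⟩ v : OrbitModule D ρ) = 0 := by
      rw [← Submodule.mem_bot (CrossProduct φ), h]
      exact Submodule.mem_top
    have := congrArg (fun F => F.coord ⟨D.base, 1, by simp⟩) h0
    exact hv (by simpa [tensor] using this)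
  · rw [or_iff_not_imp_left, ← ne_eq, Submodule.ne_bot_iff]
    rintro ⟨F, hF, hF0⟩
    obtain ⟨s, hs⟩ : ∃ s, F.coord s ≠ 0 := by
      by_contra! h
      exact hF0 (ext' h)
    have hbase : ∀ t : D.Points, D.lift t • (⟨D.base, 1, by simp⟩ : D.Points) = t :=
      fun t => Orbit.ext (D.lift_spec t)
    have htop : baseSubrepresentation N = ⊤ := by
      refine (hρ.eq_bot_or_eq_top _).resolve_left fun hbot => ?_
      have h1 := N.smul_mem (CrossProduct.basis s.val 1) hF
      rw [basis_one_smul] at h1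
      have h2 := N.smul_mem (CrossProduct.basis (φ (D.lift s)⁻¹ s.val) (D.lift s)⁻¹) h1
      have hb : (D.lift s)⁻¹ • s = (⟨D.base, 1, by simp⟩ : D.Points) := by
        rw [inv_smul_eq_iff, hbase]
      rw [smul_tensor, hb] at h2
      have h3 : ρ (D.cocycle s (D.lift s)⁻¹) (F.coord s) ∈ baseSubrepresentation N := h2
      rw [hbot] at h3
      have h4 : ρ (D.cocycle s (D.lift s)⁻¹) (F.coord s) = 0 := h3
      exact hs ((ρ.apply_bijective _).1 (by rw [h4, map_zero]))
    refine eq_top_iff.2 fun F' _ => ?_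
    rw [eq_sum_tensor F']
    refine N.sum_mem fun t _ => ?_
    obtain ⟨v, hv⟩ := (ρ.apply_bijective (D.cocycle ⟨D.base, 1, by simp⟩ (D.lift t))).2 (F'.coord t)
    have h1 : v ∈ baseSubrepresentation N := htop ▸ Submodule.mem_top
    have h2 := N.smul_mem (CrossProduct.basis (φ (D.lift t) D.base) (D.lift t)) h1
    rw [smul_tensor (D.lift t) ⟨D.base, 1, by simp⟩ v, hbase, hv] at h2
    exact h2

open scoped Classical in
-- The element permutes the blocks `s ⊗ V` after discarding some; a diagonal block is nonzero only
-- at a point fixed by `k` and equal to `x`, where it is `ρ` of the cocycle.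
theorem trace_basis [FiniteDimensional ℂ V] (x : X) (k : K) :
    LinearMap.trace ℂ (OrbitModule D ρ)
        (Algebra.lsmul ℂ ℂ (OrbitModule D ρ) (CrossProduct.basis x k : CrossProduct φ))
      = ∑ s : D.Points, if s.val = x ∧ k • s = s then ρ.character (D.cocycle s k) else 0 := by
  rw [← LinearMap.trace_conj' _ (coordEquiv D ρ), trace_pi]
  refine Finset.sum_congr rfl fun s _ => ?_
  have hc : ∀ v : V, (coordEquiv D ρ).symm (Pi.single s v) = tensor s v := by
    intro v
    ext t
    simp [coordEquiv, tensor, Pi.single_apply]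
  have h : LinearMap.proj s ∘ₗ (coordEquiv D ρ).conj
        (Algebra.lsmul ℂ ℂ (OrbitModule D ρ) (CrossProduct.basis x k : CrossProduct φ)) ∘ₗ
        LinearMap.single ℂ (fun _ => V) s
      = if s.val = x ∧ k • s = s then ρ (D.cocycle s k) else 0 := by
    ext v
    simp only [LinearMap.comp_apply, LinearEquiv.conj_apply, LinearEquiv.coe_coe,
      LinearMap.single_apply, hc, Algebra.lsmul_coe, LinearMap.proj_apply, basis_smul_tensor]
    by_cases hk : k • s = s
    · have hk' : φ k s.val = s.val := congrArg Orbit.val hk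
      by_cases hx : s.val = x
      · rw [if_pos (by rw [hk', hx]), if_pos ⟨hx, hk⟩]
        simp [hk, coordEquiv, tensor]
      · rw [if_neg (fun h => hx (by rw [h, hk'])), if_neg (fun h => hx h.1)]
        simp
    · rw [if_neg (fun h : s.val = x ∧ k • s = s => hk h.2)]
      split_ifs <;> simp [coordEquiv, tensor, Ne.symm hk]
  rw [h]
  split_ifs
  · rfl
  · simp

end OrbitModule

/-! ### Frobenius reciprocity -/

section Frobenius

variable {A : Type*} [Ring A] [Algebra ℂ A] {B : Type*} [Ring B] [Algebra ℂ B] (i : A →ₐ[ℂ] B)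
  (V : Type*) [AddCommGroup V] [Module ℂ V] [Module A V] [IsScalarTower ℂ A V]
  (W : Type*) [AddCommGroup W] [Module ℂ W] [Module B W] [IsScalarTower ℂ B W]

/-- Restriction of a map on `B ⊗_A V` to `1 ⊗ V`. -/
def inductionHomRestrict :
    (Induction i V →ₗ[B] W) →ₗ[ℂ] (V →ₗ[A] Restriction i W) where
  toFun f :=
    { toFun := fun v => (f (Submodule.Quotient.mk (1 ⊗ₜ v)) : W)
      map_add' := fun v v' => by
        rw [TensorProduct.tmul_add, Submodule.Quotient.mk_add, map_add]
        rfl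
      map_smul' := fun a v => by
        have h : (Submodule.Quotient.mk ((1 : B) ⊗ₜ (a • v)) : Induction i V)
            = i a • Submodule.Quotient.mk (1 ⊗ₜ v) := by
          rw [← Submodule.Quotient.mk_smul, eq_comm, Submodule.Quotient.eq]
          refine Submodule.subset_span ⟨1, a, v, ?_⟩
          rw [TensorProduct.smul_tmul', smul_eq_mul, mul_one, one_mul]
        rw [h, map_smul]
        rfl }
  map_add' _ _ := rfl
  map_smul' _ _ := rfl

/-- Injective because `1 ⊗ V` generates `B ⊗ V` over `B`; surjective because `b ⊗ v ↦ b g(v)` kills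
the relations when `g` is `A`-linear. -/
theorem inductionHomRestrict_bijective : Function.Bijective (inductionHomRestrict i V W) := by
  constructor
  · intro f g hfg
    refine LinearMap.ext fun t => ?_
    obtain ⟨t, rfl⟩ := Submodule.Quotient.mk_surjective _ t
    induction t using TensorProduct.induction_on with
    | zero => simp
    | add x y hx hy => rw [Submodule.Quotient.mk_add, map_add, map_add, hx, hy]
    | tmul b v =>
      have h : (b ⊗ₜ v : B ⊗[ℂ] V) = b • (1 ⊗ₜ v) := by
        rw [TensorProduct.smul_tmul', smul_eq_mul, mul_one]
      rw [h, Submodule.Quotient.mk_smul, map_smul, map_smul]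
      exact congrArg (b • ·) (LinearMap.congr_fun hfg v)
  · intro g
    let g' : V →ₗ[ℂ] W :=
      { toFun := g
        map_add' := map_add g
        map_smul' := fun c v => map_smul (g.restrictScalars ℂ) c v }
    let L : B ⊗[ℂ] V →ₗ[B] W := TensorProduct.AlgebraTensorModule.lift
      { toFun := fun b => b • g'
        map_add' := fun b b' => add_smul b b' g'
        map_smul' := fun b b' => mul_smul b b' g' }
    have hL : ∀ b v, L (b ⊗ₜ v) = b • (show W from g v) := fun b v => rfl
    refine ⟨Submodule.liftQ _ L (Submodule.span_le.2 ?_), ?_⟩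
    · rintro _ ⟨b, a, v, rfl⟩
      rw [SetLike.mem_coe, LinearMap.mem_ker, map_sub, hL, hL, map_smul, mul_smul, sub_eq_zero]
      rfl
    · ext v
      change L (1 ⊗ₜ v) = g v
      rw [hL, one_smul]

theorem finrank_induction_hom : Module.finrank ℂ (Induction i V →ₗ[B] W)
    = Module.finrank ℂ (V →ₗ[A] Restriction i W) :=
  (LinearEquiv.ofBijective _ (inductionHomRestrict_bijective i V W)).finrank_eq

end Frobenius

/-! ### Branching multiplicities -/

section Branching

variable {H : Type u} [Group H]

theorem finrank_hom_of_linearEquiv_pi {A : Type*} [Ring A] [Algebra ℂ A] {ι : Type*} [Fintype ι]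
    {V M : Type*} [AddCommGroup V] [Module A V] [AddCommGroup M] [Module ℂ M] [Module A M]
    [IsScalarTower ℂ A M] {N : ι → Type*} [∀ i, AddCommGroup (N i)] [∀ i, Module ℂ (N i)]
    [∀ i, Module A (N i)] [∀ i, IsScalarTower ℂ A (N i)] (e : M ≃ₗ[A] ∀ i, N i)
    [∀ i, FiniteDimensional ℂ (V →ₗ[A] N i)] :
    Module.finrank ℂ (V →ₗ[A] M) = ∑ i, Module.finrank ℂ (V →ₗ[A] N i) := by
  have h := fun i (c : ℂ) x => congrFun (e.toLinearMap.map_smul_of_tower c x) i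
  let Φ : (V →ₗ[A] M) ≃ₗ[ℂ] ∀ i, V →ₗ[A] N i :=
    { toFun := fun f i => LinearMap.proj i ∘ₗ e.toLinearMap ∘ₗ f
      invFun := fun g => e.symm.toLinearMap ∘ₗ LinearMap.pi g
      map_add' := fun f g => by
        funext i
        ext v
        simp
      map_smul' := fun c f => by
        funext i
        ext v
        exact h i c (f v)
      left_inv := fun f => by
        ext v
        exact e.symm_apply_apply (f v)
      right_inv := fun g => by
        funext i
        ext v
        simp }
  rw [Φ.finrank_eq]
  exact Module.finrank_pi_fintype ℂ

/-- A basis transports the action to some `ℂⁿ`, where the representatives of the classes live. This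
labels the simple summands of a representation. -/
theorem Irr.exists_linearEquiv (S : Type*) [AddCommGroup S] [Module ℂ S]
    [Module (MonoidAlgebra ℂ H) S] [IsScalarTower ℂ (MonoidAlgebra ℂ H) S] [FiniteDimensional ℂ S]
    [IsSimpleModule (MonoidAlgebra ℂ H) S] :
    ∃ τ : Irr H, Nonempty (S ≃ₗ[MonoidAlgebra ℂ H] τ.rep.asModule) := by
  let e := (Module.finBasis ℂ S).equivFun
  let σ : Representation ℂ H (Fin (Module.finrank ℂ S) → ℂ) :=
    e.conjRingEquiv.toMonoidHom.comp (Representation.ofModule' S)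
  have hσ : ∀ (g : H) (v : S), e (MonoidAlgebra.single g (1 : ℂ) • v) = σ g (e v) := by
    intro g v
    change _ = e (MonoidAlgebra.single g (1 : ℂ) • e.symm (e v))
    rw [e.symm_apply_apply]
  let f : S →ₗ[MonoidAlgebra ℂ H] σ.asModule :=
    MonoidAlgebra.equivariantOfLinearOfComm
      ((σ.asModuleEquiv.symm.toLinearMap ∘ₗ e.toLinearMap : S →ₗ[ℂ] σ.asModule)) fun g v => by
        rw [Representation.single_smul, one_smul]
        exact hσ g v
  let f' : S ≃ₗ[MonoidAlgebra ℂ H] σ.asModule := LinearEquiv.ofBijective f e.bijective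
  have hirr : σ.IsIrreducible :=
    (Representation.irreducible_iff_isSimpleModule_asModule σ).2 (IsSimpleModule.congr f'.symm)
  obtain ⟨ψ⟩ : Nonempty (σ.Equiv (Irr.rep ⟦(⟨_, σ, hirr⟩ : MatrixIrrep H)⟧)) :=
    Setoid.symm (Quotient.mk_out (⟨_, σ, hirr⟩ : MatrixIrrep H))
  refine ⟨_, ⟨f'.trans (LinearEquiv.ofBijective
    (Representation.IntertwiningMap.equivLinearMapAsModule _ _ ψ.toIntertwiningMap) ψ.bijective)⟩⟩

open scoped Classical in
theorem Irr.finrank_hom (σ τ : Irr H) :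
    Module.finrank ℂ (σ.rep.asModule →ₗ[MonoidAlgebra ℂ H] τ.rep.asModule)
      = if σ = τ then 1 else 0 := by
  rw [← (Representation.IntertwiningMap.equivLinearMapAsModule σ.rep τ.rep).finrank_eq]
  split_ifs with h
  · subst h
    exact Representation.IsIrreducible.finrank_intertwiningMap_self _
  · have : IsEmpty (σ.rep.Equiv τ.rep) := ⟨fun e => h (Irr.eq_of_equiv ⟨e⟩)⟩
    exact Module.finrank_zero_of_subsingleton

/-- Only `ρ` has to be decomposed, as a sum of irreducibles `τ i`: the left side is then the sum of
the `branching (τ i) σ`, and by Schur's lemma `branching θ ρ` counts the `i` with `τ i = θ`. -/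
theorem finrank_hom_eq_sum_branching [Finite H] {V W : Type*} [AddCommGroup V] [Module ℂ V]
    [FiniteDimensional ℂ V] [AddCommGroup W] [Module ℂ W] [FiniteDimensional ℂ W]
    (ρ : Representation ℂ H V) (σ : Representation ℂ H W) :
    Module.finrank ℂ (ρ.asModule →ₗ[MonoidAlgebra ℂ H] σ.asModule)
      = ∑ τ : Irr H, branching τ ρ * branching τ σ := by
  classical
  have : NeZero (Nat.card H : ℂ) := ⟨Nat.cast_ne_zero.2 Nat.card_pos.ne'⟩
  have : Module.Finite (MonoidAlgebra ℂ H) ρ.asModule := Module.Finite.of_restrictScalars_finite ℂ _ _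
  obtain ⟨n, S, e, hS⟩ :=
    IsSemisimpleModule.exists_linearEquiv_fin_dfinsupp (MonoidAlgebra ℂ H) ρ.asModule
  have hfd : ∀ i, FiniteDimensional ℂ (S i) := fun i =>
    inferInstanceAs (FiniteDimensional ℂ ((S i).restrictScalars ℂ))
  choose τ hτ using fun i => Irr.exists_linearEquiv (H := H) (S i)
  let e' : ρ.asModule ≃ₗ[MonoidAlgebra ℂ H] ∀ i, (τ i).rep.asModule :=
    e.trans ((DFinsupp.linearEquivFunOnFintype).trans
      (LinearEquiv.piCongrRight fun i => (hτ i).some))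
  have hleft : Module.finrank ℂ (ρ.asModule →ₗ[MonoidAlgebra ℂ H] σ.asModule)
      = ∑ i, branching (τ i) σ := by
    rw [(LinearEquiv.congrLeft σ.asModule ℂ e').finrank_eq,
      ← (LinearMap.lsum (MonoidAlgebra ℂ H) (fun i => (τ i).rep.asModule) ℂ).finrank_eq]
    exact Module.finrank_pi_fintype ℂ
  have hright : ∀ θ : Irr H, branching θ ρ = ∑ i, if θ = τ i then 1 else 0 := by
    intro θ
    simp only [← Irr.finrank_hom]
    exact finrank_hom_of_linearEquiv_pi e'
  simp only [hleft, hright, Finset.sum_mul]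
  rw [Finset.sum_comm]
  simp

end Branching

/-! ### The multiplicity formula -/

section Formula

/-- Each `k` factors uniquely as `lift s * a` with `a` in the isotropy group, `s` being the image of
the base point under `k`. -/
theorem card_points_mul_card_iso {K : Type*} [Group K] {X : Type*} {φ : K →* Equiv.Perm X}
    (D : PointedOrbit φ) : Nat.card D.Points * Nat.card D.Iso = Nat.card K := by
  rw [← Nat.card_prod]
  refine Nat.card_congr (Equiv.ofBijective (fun p => D.lift p.1 * p.2.1) ⟨?_, fun k => ?_⟩)
  · rintro ⟨s, a⟩ ⟨t, b⟩ (h : D.lift s * a.1 = D.lift t * b.1)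
    have ha : ∀ (s : D.Points) (a : D.Iso), φ (D.lift s * a.1) D.base = s.val := by
      intro s a
      have := a.2
      change φ a.1 D.base = D.base at this
      rw [map_mul, Equiv.Perm.mul_apply, this, D.lift_spec]
    have hst : s = t := Orbit.ext (by rw [← ha s a, ← ha t b, h])
    subst hst
    exact Prod.ext rfl (Subtype.ext (mul_left_cancel h))
  · refine ⟨⟨⟨φ k D.base, k, rfl⟩, ⟨(D.lift ⟨φ k D.base, k, rfl⟩)⁻¹ * k, ?_⟩⟩, ?_⟩
    · change φ _ D.base = D.base
      rw [map_mul, Equiv.Perm.mul_apply, map_inv, Equiv.Perm.inv_eq_iff_eq, D.lift_spec]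
    · simp

variable {K : Type*} [Group K] {X : Type*} {φ : K →* Equiv.Perm X} (D : PointedOrbit φ)

/-- At a fixed point both lifts in the cocycle coincide, so the characters in the traces become
those of `ρ̃` and `π̃`. -/
theorem PointedOrbit.cocycle_eq_conjIso (s : D.Points) (k : K) (hk : φ k s.val = s.val) :
    D.cocycle s k = D.conjIso s ⟨k, hk⟩ := by
  have h : k • s = s := Orbit.ext hk
  apply Subtype.ext
  simp [PointedOrbit.cocycle, PointedOrbit.conjIso, h]

theorem sum_character_mul_character {H : Type*} [Group H] [Finite H] {V W : Type*} [AddCommGroup V]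
    [Module ℂ V] [FiniteDimensional ℂ V] [AddCommGroup W] [Module ℂ W] [FiniteDimensional ℂ W]
    [Fintype H] (ρ : Representation ℂ H V) (σ : Representation ℂ H W) :
    ∑ g : H, σ.character g * ρ.character g⁻¹
      = Nat.card H * ∑ τ : Irr H, (branching τ ρ : ℂ) * branching τ σ := by
  have hc : (Nat.card H : ℂ) ≠ 0 := Nat.cast_ne_zero.2 Nat.card_pos.ne'
  have : Invertible (Nat.card H : ℂ) := invertibleOfNonzero hc
  have h := Representation.card_inv_mul_sum_char_mul_char_eq_finrank ρ σ
  rw [(Representation.IntertwiningMap.equivLinearMapAsModule ρ σ).finrank_eq,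
    finrank_hom_eq_sum_branching, inv_mul_eq_iff_eq_mul₀ hc] at h
  rw [h]
  push_cast
  rfl

variable {G : Type*} [Group G] [Fintype G] {K : Subgroup G} [Fintype K] (R : Transversal K)
  (C : PointedOrbit (conjAction G)) {W : Type*} [AddCommGroup W] [Module ℂ W]
  [FiniteDimensional ℂ W] (π : Representation ℂ C.Iso W)

instance : FiniteDimensional ℂ (Restriction R.inclusion (OrbitModule C π)) :=
  inferInstanceAs (FiniteDimensional ℂ (OrbitModule C π))

open scoped Classical in
-- The image of `δ_r ⊗ k` is the sum of the `δ_{ry} ⊗ k`. A point `c` meets at most one of these,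
-- with `y = r⁻¹c`, and it does so exactly when `r⁻¹c ∈ K`.
theorem trace_restriction_basis (r : R.carrier) (k : K) :
    LinearMap.trace ℂ (Restriction R.inclusion (OrbitModule C π))
        (Algebra.lsmul ℂ ℂ (Restriction R.inclusion (OrbitModule C π))
          (CrossProduct.basis r k : R.Xi))
      = ∑ c : C.Points, if (r : G)⁻¹ * c.val ∈ K ∧ (k : G) • c = c then
          π.character (C.cocycle c k) else 0 := by
  have h : Algebra.lsmul ℂ ℂ (Restriction R.inclusion (OrbitModule C π))
      (CrossProduct.basis r k : R.Xi)
      = Algebra.lsmul ℂ ℂ (OrbitModule C π) (R.inclusion (CrossProduct.basis r k)) := rfl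
  refine (congrArg (LinearMap.trace ℂ (OrbitModule C π)) h).trans ?_
  rw [R.inclusion_basis, map_sum, map_sum]
  simp only [OrbitModule.trace_basis]
  rw [Finset.sum_comm]
  refine Finset.sum_congr rfl fun c _ => ?_
  by_cases hc : (r : G)⁻¹ * c.val ∈ K
  · rw [Finset.sum_eq_single ⟨(r : G)⁻¹ * c.val, hc⟩]
    · simp [hc]
    · intro y _ hy
      rw [if_neg]
      rintro ⟨h, -⟩
      exact hy (Subtype.ext (by simp [h]))
    · simp
  · rw [if_neg (fun h => hc h.1)]
    refine Finset.sum_eq_zero fun y _ => if_neg ?_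
    rintro ⟨h, -⟩
    exact hc (by simp [h])

open scoped Classical in
theorem finrank_hom_restriction (O : PointedOrbit R.action) {V : Type*} [AddCommGroup V]
    [Module ℂ V] [FiniteDimensional ℂ V] (ρ : Representation ℂ O.Iso V) :
    (Module.finrank ℂ
        (OrbitModule O ρ →ₗ[R.Xi] Restriction R.inclusion (OrbitModule C π)) : ℂ)
      = (Nat.card K : ℂ)⁻¹ * ∑ r : O.Points, ∑ c : C.Points,
          if (r.val : G)⁻¹ * c.val ∈ K then
            (Nat.card (JointIsotropy R r.val c.val) : ℂ) *
              ∑ τ : Irr (JointIsotropy R r.val c.val),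
                (branching τ (ρ.comp ((O.conjIso r).comp (JointIsotropy.toLeft R r.val c.val))) : ℂ) *
                  (branching τ (π.comp ((C.conjIso c).comp (JointIsotropy.toRight R r.val c.val))) : ℂ)
          else 0 := by
  have : Fintype R.carrier := Fintype.ofFinite _
  rw [CrossProduct.finrank_hom]
  congr 1
  simp only [OrbitModule.trace_basis, trace_restriction_basis]
  -- The second character is taken at `δ_{k⁻¹x} ⊗ k⁻¹`; since `k` fixes `s`, its condition is the
  -- same as `s = x`, so the sum over `x` will collapse.
  have hcond : ∀ (x : R.carrier) (k : K) (s : O.Points),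
      (s.val = R.action k⁻¹ x ∧ k⁻¹ • s = s) ↔ (s.val = x ∧ k • s = s) := by
    intro x k s
    have h1 : k⁻¹ • s = s ↔ k • s = s := by
      rw [inv_smul_eq_iff, eq_comm]
    rw [h1, and_congr_left_iff]
    intro h
    have h2 : R.action k s.val = s.val := congrArg Orbit.val h
    rw [map_inv, eq_comm, Equiv.Perm.inv_eq_iff_eq, h2, eq_comm]
  simp only [hcond]
  calc _ = ∑ s : O.Points, ∑ k : K, ∑ x : R.carrier, if s.val = x ∧ k • s = s then
        (∑ c : C.Points, if (x : G)⁻¹ * c.val ∈ K ∧ (k : G) • c = c then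
          π.character (C.cocycle c k) else 0) * ρ.character (O.cocycle s k⁻¹) else 0 := by
        simp only [Finset.mul_sum, mul_ite, mul_zero]
        exact Finset.sum_comm.trans
          ((Finset.sum_congr rfl fun k _ => Finset.sum_comm).trans Finset.sum_comm)
    _ = ∑ s : O.Points, ∑ k : K, if k • s = s then
        (∑ c : C.Points, if (s.val : G)⁻¹ * c.val ∈ K ∧ (k : G) • c = c then
          π.character (C.cocycle c k) else 0) * ρ.character (O.cocycle s k⁻¹) else 0 := by
        refine Finset.sum_congr rfl fun s _ => Finset.sum_congr rfl fun k _ => ?_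
        rw [Finset.sum_eq_single s.val]
        · simp
        · intro x _ hx
          exact if_neg fun h => hx h.1.symm
        · simp
    _ = _ := by
        refine Finset.sum_congr rfl fun s _ => ?_
        calc _ = ∑ k : K, ∑ c : C.Points, if k • s = s ∧ (s.val : G)⁻¹ * c.val ∈ K ∧ (k : G) • c = c
              then π.character (C.cocycle c k) * ρ.character (O.cocycle s k⁻¹) else 0 := by
              refine Finset.sum_congr rfl fun k _ => ?_
              rw [Finset.sum_mul]
              by_cases hk : k • s = s <;> simp [hk, ite_mul]
          _ = _ := by
              rw [Finset.sum_comm]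
              refine Finset.sum_congr rfl fun c _ => ?_
              by_cases hc : (s.val : G)⁻¹ * c.val ∈ K
              · simp only [hc, true_and, if_true]
                have : Fintype (JointIsotropy R s.val c.val) := Fintype.ofFinite _
                -- The elements `k` fixing both `s` and `c` are exactly those of the joint isotropy
                -- group.
                rw [← sum_character_mul_character, ← Finset.sum_filter,
                  Finset.sum_subtype (p := (· ∈ JointIsotropy R s.val c.val))]
                · refine Finset.sum_congr rfl fun m _ => ?_
                  rw [C.cocycle_eq_conjIso c m.1 m.2.2, O.cocycle_eq_conjIso s m.1⁻¹ (m⁻¹).2.1]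
                  rfl
                · intro k
                  rw [Finset.mem_filter]
                  refine ⟨fun h => ⟨congrArg Orbit.val h.2.1, congrArg Orbit.val h.2.2⟩,
                    fun h => ⟨Finset.mem_univ _, Orbit.ext h.1, Orbit.ext h.2⟩⟩
              · simp [hc]

end Formula

end KitaevBoundary

end

/-! ### The multiplicity theorem -/

open KitaevBoundary

theorem mainTheorem5 {G : Type*} [Group G] [Fintype G] (K : Subgroup G) [Fintype K]
    (R : Transversal K)
    (O : PointedOrbit R.action) {V : Type*} [AddCommGroup V] [Module ℂ V] [FiniteDimensional ℂ V]
    (ρ : Representation ℂ O.Iso V) (hρ : ρ.IsIrreducible)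
    (C : PointedOrbit (conjAction G)) {W : Type*} [AddCommGroup W] [Module ℂ W]
    [FiniteDimensional ℂ W] (π : Representation ℂ C.Iso W) (hπ : π.IsIrreducible) :
    ∃ n : ℕ,
      HasMultiplicity R.Xi (OrbitModule O ρ) (Restriction R.inclusion (OrbitModule C π)) n ∧
      HasMultiplicity (QuantumDouble G) (OrbitModule C π)
        (Induction R.inclusion (OrbitModule O ρ)) n ∧
      Module.finrank ℂ
        (OrbitModule O ρ →ₗ[R.Xi] Restriction R.inclusion (OrbitModule C π)) = n ∧
      Module.finrank ℂ
        (Induction R.inclusion (OrbitModule O ρ) →ₗ[QuantumDouble G] OrbitModule C π) = n ∧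
      (n : ℚ) = (Nat.card G : ℚ) /
          (Nat.card O.Points * Nat.card C.Points * Nat.card O.Iso * Nat.card C.Iso) *
        ∑ r : O.Points, ∑ c : C.Points,
          open scoped Classical in
          if ((r.val : G)⁻¹ * c.val ∈ K) then
            (Nat.card (JointIsotropy R r.val c.val) : ℚ) *
              ∑ τ : Irr (JointIsotropy R r.val c.val),
                (branching τ (ρ.comp ((O.conjIso r).comp (JointIsotropy.toLeft R r.val c.val))) : ℚ) *
                  (branching τ (π.comp ((C.conjIso c).comp (JointIsotropy.toRight R r.val c.val))) : ℚ)
          else 0 := by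
  classical
  have hV := OrbitModule.isSimpleModule (D := O) hρ
  have hW := OrbitModule.isSimpleModule (D := C) hπ
  have : Fintype R.carrier := Fintype.ofFinite _
  have hsV : IsSemisimpleModule R.Xi (Restriction R.inclusion (OrbitModule C π)) :=
    CrossProduct.isSemisimpleModule
  have hsW : IsSemisimpleModule (QuantumDouble G) (Induction R.inclusion (OrbitModule O ρ)) :=
    CrossProduct.isSemisimpleModule
  have hind := finrank_induction_hom R.inclusion (OrbitModule O ρ) (OrbitModule C π)
  refine ⟨_, hasMultiplicity_finrank, ?_, rfl, hind, ?_⟩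
  -- Frobenius reciprocity counts maps out of the induced module, whereas the multiplicity counts
  -- maps into it.
  · rw [← hind, CrossProduct.finrank_hom_comm]
    exact hasMultiplicity_finrank
  · have hG : (Nat.card G : ℚ) ≠ 0 := Nat.cast_ne_zero.2 Nat.card_pos.ne'
    have hcard : (Nat.card G : ℚ) /
        (Nat.card O.Points * Nat.card C.Points * Nat.card O.Iso * Nat.card C.Iso)
          = (Nat.card K : ℚ)⁻¹ := by
      rw [← card_points_mul_card_iso O]
      rw [← card_points_mul_card_iso C] at hG ⊢
      push_cast at hG ⊢
      rw [show (Nat.card O.Points * Nat.card C.Points * Nat.card O.Iso * Nat.card C.Iso : ℚ)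
        = (Nat.card C.Points * Nat.card C.Iso) * (Nat.card O.Points * Nat.card O.Iso) by ring,
        div_mul_cancel_left₀ hG]
    rw [hcard]
    -- The character computation takes place in `ℂ`, so the rational identity is checked there.
    refine Rat.cast_injective (α := ℂ) ?_
    have h := finrank_hom_restriction R C π O ρ
    push_cast
    convert h using 5
    split_ifs <;> simp
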